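/- For a group $G$ and a prime $p$ define, with $[H,K]$ and $H^p$ denoting the subgroups generated by the commutators $[h,k]$ ($h\in H$, $k\in K$) and by the $p$-th powers $h^p$ ($h\in H$), respectively: - the lower central filtration: $G^{(1)}=G$, $G^{(i)}=[G,G^{(i-1)}]$ for $i\ge 2$; - the $p$-Zassenhaus filtration: $G_{(1,p)}=G$, $G_{(i,p)}=(G_{(\lceil i/p\rceil,p)})^p\prod_{j+l=i,\ j,l\ge1}[G_{(j,p)},G_{(l,p)}]$ for $i\ge2$; - the lower $p$-central filtration: $G^{(1,p)}=G$, $G^{(i,p)}=(G^{(i-1,p)})^p[G,G^{(i-1,p)}]$ for $i\ge2$. In the profinite setting the subgroups are taken to be closed; thus there $G^{(1)}=G$ and $G^{(i)}$ is the closed subgroup generated by the commutators of elements of $G$ with elements of $G^{(i-1)}$, for $i\ge 2$. For a commutative ring $R$ let $\mathbb U_n(R)$ be the group of all upper-triangular unipotent $n\times n$ matrices over $R$. For a prime $p$ let $G(n,p)$ be the group of all upper-triangular unipotent $n\times n$ matrices $(a_{ij})$ over $\mathbb Z/p^n\mathbb Z$ such that $a_{ij}\in p^{j-i}\mathbb Z/p^n\mathbb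 Z$ for all $i\le j$. For a set $\Pi$ of prime numbers let $\mathcal C$ be the family of all finite groups whose order is a product of primes in $\Pi$, and let $\hat{\mathbb Z}_{\mathcal C}=\prod_{p\in\Pi}\mathbb Z_p$ with the product topology. Let $n\ge1$ be an integer. Then: (a) $\mathbb U_n(\mathbb Z)^{(n)}=1$ in the discrete setting. (b) For every set $\Pi$ of prime numbers, with $\mathcal C$ as above, $\mathbb U_n(\hat{\mathbb Z}_{\mathcal C})^{(n)}=1$ in the profinite setting. (c) For every prime $p$, $\mathbb U_n(\mathbb F_p)_{(n,p)}=1$. (d) For every prime $p$, $G(n,p)^{(n,p)}=1$. -/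

import Mathlib

/-! ### Groups of unipotent matrices -/

/-- `U n R`: the group of all upper-triangular unipotent `n × n` matrices over `R`, i.e. matrices
with `0` below the diagonal and `1` on it. Such matrices have determinant `1`
(see `exists_mem_unipotentGroup`), so the group is realized inside `SL n R`. When `R` is a
topological ring it carries the topology induced from the space of matrices. -/
def unipotentGroup (n : ℕ) (R : Type*) [CommRing R] :
    Subgroup (Matrix.SpecialLinearGroup (Fin n) R) where
  carrier := {g | (∀ i j : Fin n, j < i → g.1 i j = 0) ∧ ∀ i : Fin n, g.1 i i = 1}
  one_mem' := ⟨fun i j h => by simp [h.ne'], fun i => by simp⟩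
  mul_mem' := by
    rintro a b ⟨ha, ha'⟩ ⟨hb, hb'⟩
    have A : a.1.BlockTriangular id := fun i j h => ha i j h
    have B : b.1.BlockTriangular id := fun i j h => hb i j h
    refine ⟨fun i j h => (A.mul B) h, fun i => ?_⟩
    rw [Matrix.SpecialLinearGroup.coe_mul, Matrix.mul_apply, Finset.sum_eq_single i]
    · rw [ha' i, hb' i, one_mul]
    · intro k _ hk
      rcases lt_or_gt_of_ne hk with h | h
      · rw [ha i k h, zero_mul]
      · rw [hb k i h, mul_zero]
    · simp
  inv_mem' := by
    rintro a ⟨ha, ha'⟩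
    have A : a.1.BlockTriangular id := fun i j h => ha i j h
    have h1 : a.1 * (a⁻¹).1 = 1 := by
      rw [← Matrix.SpecialLinearGroup.coe_mul, mul_inv_cancel, Matrix.SpecialLinearGroup.coe_one]
    have h2 : (a⁻¹).1 * a.1 = 1 := by
      rw [← Matrix.SpecialLinearGroup.coe_mul, inv_mul_cancel, Matrix.SpecialLinearGroup.coe_one]
    have : Invertible a.1 := ⟨(a⁻¹).1, h2, h1⟩
    have hinv : (a⁻¹).1 = a.1⁻¹ := (Matrix.inv_eq_left_inv h2).symm
    have B : (a⁻¹).1.BlockTriangular id := by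
      rw [hinv]; exact Matrix.blockTriangular_inv_of_blockTriangular A
    refine ⟨fun i j h => B h, fun i => ?_⟩
    have h3 := congrFun (congrFun h1 i) i
    rw [Matrix.mul_apply, Finset.sum_eq_single i, ha' i, one_mul, Matrix.one_apply_eq] at h3
    · exact h3
    · intro k _ hk
      rcases lt_or_gt_of_ne hk with h | h
      · rw [ha i k h, zero_mul]
      · have h4 : (a⁻¹).1 k i = 0 := B h
        rw [h4, mul_zero]
    · simp

/-- Every upper-triangular matrix with ones on the diagonal occurs in `unipotentGroup n R`. -/
theorem exists_mem_unipotentGroup {n : ℕ} {R : Type*} [CommRing R] (M : Matrix (Fin n) (Fin n) R)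
    (h0 : ∀ i j : Fin n, j < i → M i j = 0) (h1 : ∀ i : Fin n, M i i = 1) :
    ∃ g ∈ unipotentGroup n R, g.1 = M := by
  have A : M.BlockTriangular id := fun i j h => h0 i j h
  refine ⟨⟨M, ?_⟩, ⟨h0, h1⟩, rfl⟩
  rw [Matrix.det_of_isUpperTriangular A]
  simp [h1]

/-- `G(n, p)`: the group of all upper-triangular unipotent `n × n` matrices `(a i j)` over
`ℤ/p^n` such that `a i j ∈ p^(j-i) ℤ/p^n` for all `i ≤ j`. -/
def groupG (n p : ℕ) [Fact p.Prime] :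
    Subgroup (Matrix.SpecialLinearGroup (Fin n) (ZMod (p ^ n))) :=
  let carrierG : Submonoid (Matrix.SpecialLinearGroup (Fin n) (ZMod (p ^ n))) :=
    { carrier := {g | g ∈ unipotentGroup n (ZMod (p ^ n)) ∧ ∀ i j : Fin n, i ≤ j →
        g.1 i j ∈ Ideal.span {(p : ZMod (p ^ n)) ^ ((j : ℕ) - (i : ℕ))}}
      one_mem' := by
        refine ⟨one_mem _, fun i j h => ?_⟩
        rcases h.eq_or_lt with rfl | h
        · simp
        · simp [Matrix.one_apply_ne h.ne]
      mul_mem' := by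
        rintro a b ⟨ha, ha'⟩ ⟨hb, hb'⟩
        refine ⟨mul_mem ha hb, fun i j h => ?_⟩
        rw [Matrix.SpecialLinearGroup.coe_mul, Matrix.mul_apply]
        refine Ideal.sum_mem _ fun k _ => ?_
        rcases lt_or_ge k i with hk | hk
        · rw [ha.1 i k hk, zero_mul]; exact zero_mem _
        rcases lt_or_ge j k with hk' | hk'
        · rw [hb.1 k j hk', mul_zero]; exact zero_mem _
        have h1 := Ideal.mul_mem_mul (ha' i k hk) (hb' k j hk')
        rw [Ideal.span_singleton_mul_span_singleton, ← pow_add] at h1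
        have h2 : ((k : ℕ) - (i : ℕ)) + ((j : ℕ) - (k : ℕ)) = (j : ℕ) - (i : ℕ) := by
          have := Fin.le_def.1 hk
          have := Fin.le_def.1 hk'
          omega
        rwa [h2] at h1 }
  { carrierG with
    inv_mem' := by
      intro g hg
      have : NeZero (p ^ n) := ⟨pow_ne_zero _ (Fact.out : p.Prime).ne_zero⟩
      have h : g⁻¹ = g ^ (orderOf g - 1) := by
        rw [inv_eq_iff_mul_eq_one, ← pow_succ', Nat.sub_add_cancel (orderOf_pos g),
          pow_orderOf_eq_one]
      show g⁻¹ ∈ carrierG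
      rw [h]
      exact pow_mem hg _ }

theorem mem_groupG {n p : ℕ} [Fact p.Prime]
    {g : Matrix.SpecialLinearGroup (Fin n) (ZMod (p ^ n))} :
    g ∈ groupG n p ↔ g ∈ unipotentGroup n (ZMod (p ^ n)) ∧ ∀ i j : Fin n, i ≤ j →
      g.1 i j ∈ Ideal.span {(p : ZMod (p ^ n)) ^ ((j : ℕ) - (i : ℕ))} :=
  Iff.rfl

/-! ### The profinite ring `∏_{p ∈ Π} ℤ_p` -/

instance factPrimeOfPrimes (p : Nat.Primes) : Fact (Nat.Prime (p : ℕ)) := ⟨p.2⟩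

/-- For a set `P` of prime numbers and the formation of all finite groups whose order is a product
of primes in `P`: the ring `∏_{p ∈ P} ℤ_p`, with the product topology. -/
abbrev ZHat (P : Set Nat.Primes) : Type := ∀ p : P, ℤ_[((p : Nat.Primes) : ℕ)]

/-! ### Filtrations of a group

All filtrations are indexed by `i = 1, 2, …`; the value at the unused index `0` is set to `⊤`. -/

section Filtrations

variable (G : Type*) [Group G]

/-- The lower central filtration `G^(i)` in the discrete setting:
`G^(1) = G` and `G^(i) = [G, G^(i-1)]` for `i ≥ 2`. -/
def lowerCentralFiltration : ℕ → Subgroup G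
  | 0 => ⊤
  | 1 => ⊤
  | i + 2 => ⁅(⊤ : Subgroup G), lowerCentralFiltration (i + 1)⁆

theorem lowerCentralFiltration_succ_eq_lowerCentralSeries (i : ℕ) :
    lowerCentralFiltration G (i + 1) = (⊤ : Subgroup G).lowerCentralSeries i := by
  induction i with
  | zero => rfl
  | succ i ih =>
    rw [lowerCentralFiltration, ih, Subgroup.lowerCentralSeries_succ, Subgroup.commutator_comm]

/-- The lower central filtration `G^(i)` in the profinite setting: `G^(1) = G`, and `G^(i)` is the
closed subgroup generated by the commutators of `G` with `G^(i-1)` for `i ≥ 2`. -/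
def closedLowerCentralFiltration [TopologicalSpace G] [IsTopologicalGroup G] : ℕ → Subgroup G
  | 0 => ⊤
  | 1 => ⊤
  | i + 2 => (⁅(⊤ : Subgroup G), closedLowerCentralFiltration (i + 1)⁆).topologicalClosure

variable {G} in
/-- `H^p`: the subgroup generated by all `p`-th powers of elements of `H`. -/
def Subgroup.powSubgroup (H : Subgroup G) (p : ℕ) : Subgroup G :=
  Subgroup.closure {x | ∃ h ∈ H, h ^ p = x}

/-- The lower `p`-central filtration `G^(i,p)`:
`G^(1,p) = G` and `G^(i,p) = (G^(i-1,p))^p [G, G^(i-1,p)]` for `i ≥ 2`. -/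
def lowerPCentralFiltration (p : ℕ) : ℕ → Subgroup G
  | 0 => ⊤
  | 1 => ⊤
  | i + 2 => (lowerPCentralFiltration p (i + 1)).powSubgroup p ⊔
      ⁅(⊤ : Subgroup G), lowerPCentralFiltration p (i + 1)⁆

/-- The `p`-Zassenhaus filtration `G_(i,p)`: `G_(1,p) = G` and
`G_(i,p) = (G_(⌈i/p⌉,p))^p ∏_{j+l=i} [G_(j,p), G_(l,p)]` for `i ≥ 2`, where `j, l ≥ 1`. -/
def zassenhausFiltration (p : ℕ) [hp : Fact p.Prime] (i : ℕ) : Subgroup G :=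
  if _hi : i ≤ 1 then ⊤
  else (zassenhausFiltration p (i ⌈/⌉ p)).powSubgroup p ⊔
    ⨆ (j : ℕ) (_hj : 1 ≤ j ∧ j < i), ⁅zassenhausFiltration p j, zassenhausFiltration p (i - j)⁆
termination_by i
decreasing_by
  · have h2 := hp.out.two_le
    rw [Nat.ceilDiv_eq_add_pred_div, Nat.div_lt_iff_lt_mul (by omega)]
    have : 2 * p ≤ i * p := Nat.mul_le_mul_right p (by omega)
    nlinarith [Nat.mul_le_mul (show 2 ≤ i by omega) h2, Nat.sub_add_cancel (show 1 ≤ i + p by omega)]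
  · omega
  · omega

end Filtrations

/-- A descending multiplicative filtration of a ring by additive subgroups. -/
structure RingFiltration (A : Type*) [Ring A] where
  /-- The terms of the filtration. -/
  toFun : ℕ → AddSubgroup A
  antitone : Antitone toFun
  one_mem : (1 : A) ∈ toFun 0
  mul_mem : ∀ {j l : ℕ} {x y : A}, x ∈ toFun j → y ∈ toFun l → x * y ∈ toFun (j + l)

namespace RingFiltration

variable {A G : Type*} [Ring A] [Group G] (F : RingFiltration A)

theorem pow_mem {k : ℕ} {x : A} (hx : x ∈ F.toFun k) (m : ℕ) : x ^ m ∈ F.toFun (m * k) := by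
  induction m with
  | zero => simpa using F.one_mem
  | succ m ih =>
    rw [pow_succ, Nat.succ_mul]
    exact F.mul_mem ih hx

/-- The subgroup of all elements congruent to `1` modulo the `k`-th term of the filtration. -/
def dimSubgroup (φ : G →* A) (hφ : ∀ g, φ g ∈ F.toFun 0) (k : ℕ) : Subgroup G where
  carrier := {g | φ g - 1 ∈ F.toFun k}
  one_mem' := by simp
  mul_mem' := by
    intro g h hg hh
    have e : φ (g * h) - 1 = (φ g - 1) * φ h + (φ h - 1) := by
      rw [map_mul]; noncomm_ring
    show φ (g * h) - 1 ∈ F.toFun k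
    rw [e]
    exact add_mem (F.mul_mem hg (hφ h)) hh
  inv_mem' := by
    intro g hg
    have e : φ g⁻¹ - 1 = -(φ g⁻¹ * (φ g - 1)) := by
      rw [mul_sub, ← map_mul, inv_mul_cancel, map_one, mul_one, neg_sub]
    show φ g⁻¹ - 1 ∈ F.toFun k
    rw [e]
    simpa using neg_mem (F.mul_mem (hφ g⁻¹) hg)

variable {F} {φ : G →* A} {hφ : ∀ g, φ g ∈ F.toFun 0}

theorem mem_dimSubgroup {k : ℕ} {g : G} :
    g ∈ F.dimSubgroup φ hφ k ↔ φ g - 1 ∈ F.toFun k := Iff.rfl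

theorem dimSubgroup_antitone : Antitone (F.dimSubgroup φ hφ) :=
  fun _ _ h _ hg => F.antitone h hg

theorem commutator_dimSubgroup_le (j l : ℕ) :
    ⁅F.dimSubgroup φ hφ j, F.dimSubgroup φ hφ l⁆ ≤ F.dimSubgroup φ hφ (j + l) := by
  rw [Subgroup.commutator_le]
  intro g hg h hh
  rw [mem_dimSubgroup] at *
  have e : φ (g * h * g⁻¹ * h⁻¹) - 1 =
      ((φ g - 1) * (φ h - 1) - (φ h - 1) * (φ g - 1)) * φ (h * g)⁻¹ := by
    have e1 : (φ g - 1) * (φ h - 1) - (φ h - 1) * (φ g - 1) = φ (g * h) - φ (h * g) := by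
      simp only [map_mul]; noncomm_ring
    rw [e1, sub_mul, ← map_mul, ← map_mul, mul_inv_cancel, map_one,
      mul_inv_rev, ← mul_assoc]
  rw [commutatorElement_def, e]
  refine F.mul_mem (l := 0) (sub_mem (F.mul_mem hg hh) ?_) (hφ _)
  have hm := F.mul_mem hh hg
  rwa [add_comm] at hm

theorem powSubgroup_dimSubgroup_le_of_charP (p : ℕ) [Fact p.Prime] [CharP A p] (k : ℕ) :
    (F.dimSubgroup φ hφ k).powSubgroup p ≤ F.dimSubgroup φ hφ (p * k) := by
  rw [Subgroup.powSubgroup, Subgroup.closure_le]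
  rintro _ ⟨g, hg, rfl⟩
  have e : φ (g ^ p) - 1 = (φ g - 1) ^ p := by
    rw [sub_pow_char_of_commute _ (Commute.one_right _), one_pow, map_pow]
  show φ (g ^ p) - 1 ∈ F.toFun (p * k)
  rw [e]
  exact F.pow_mem hg p

theorem powSubgroup_dimSubgroup_le_of_mem {p : ℕ} (hp : (p : A) ∈ F.toFun 1)
    (h1 : F.dimSubgroup φ hφ 1 = ⊤) (k : ℕ) :
    (F.dimSubgroup φ hφ k).powSubgroup p ≤ F.dimSubgroup φ hφ (k + 1) := by
  rw [Subgroup.powSubgroup, Subgroup.closure_le]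
  rintro _ ⟨g, hg, rfl⟩
  have hsum : ∑ m ∈ Finset.range p, φ g ^ m ∈ F.toFun 1 := by
    have e : ∑ m ∈ Finset.range p, φ g ^ m
        = ∑ m ∈ Finset.range p, (φ (g ^ m) - 1) + (p : A) := by
      simp [Finset.sum_sub_distrib]
    rw [e]
    refine add_mem (sum_mem fun m _ => ?_) hp
    exact mem_dimSubgroup.1 (h1 ▸ Subgroup.mem_top (g ^ m) : g ^ m ∈ F.dimSubgroup φ hφ 1)
  show φ (g ^ p) - 1 ∈ F.toFun (k + 1)
  rw [map_pow, ← geom_sum_mul, add_comm]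
  exact F.mul_mem hsum hg

theorem lowerCentralFiltration_le (h1 : F.dimSubgroup φ hφ 1 = ⊤) (i : ℕ) :
    lowerCentralFiltration G (i + 1) ≤ F.dimSubgroup φ hφ (i + 1) := by
  induction i with
  | zero => rw [h1]; exact le_top
  | succ i ih =>
    rw [lowerCentralFiltration, ← h1, add_comm (i + 1)]
    exact (Subgroup.commutator_mono le_rfl ih).trans (commutator_dimSubgroup_le _ _)

theorem closedLowerCentralFiltration_le [TopologicalSpace G] [IsTopologicalGroup G]
    (h1 : F.dimSubgroup φ hφ 1 = ⊤)
    (hF : ∀ k, IsClosed (F.dimSubgroup φ hφ k : Set G)) (i : ℕ) :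
    closedLowerCentralFiltration G (i + 1) ≤ F.dimSubgroup φ hφ (i + 1) := by
  induction i with
  | zero => rw [h1]; exact le_top
  | succ i ih =>
    rw [closedLowerCentralFiltration]
    refine Subgroup.topologicalClosure_minimal _ ?_ (hF _)
    rw [← h1, add_comm (i + 1)]
    exact (Subgroup.commutator_mono le_rfl ih).trans (commutator_dimSubgroup_le _ _)

theorem lowerPCentralFiltration_le {p : ℕ} (hp : (p : A) ∈ F.toFun 1)
    (h1 : F.dimSubgroup φ hφ 1 = ⊤) (i : ℕ) :
    lowerPCentralFiltration G p (i + 1) ≤ F.dimSubgroup φ hφ (i + 1) := by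
  induction i with
  | zero => rw [h1]; exact le_top
  | succ i ih =>
    rw [lowerPCentralFiltration]
    refine sup_le ?_ ?_
    · refine le_trans (Subgroup.closure_mono ?_) (powSubgroup_dimSubgroup_le_of_mem hp h1 _)
      rintro _ ⟨g, hg, rfl⟩
      exact ⟨g, ih hg, rfl⟩
    · rw [← h1, add_comm (i + 1)]
      exact (Subgroup.commutator_mono le_rfl ih).trans (commutator_dimSubgroup_le _ _)

theorem zassenhausFiltration_le (p : ℕ) [hp : Fact p.Prime] [CharP A p]
    (h1 : F.dimSubgroup φ hφ 1 = ⊤) (i : ℕ) :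
    zassenhausFiltration G p i ≤ F.dimSubgroup φ hφ i := by
  induction i using Nat.strong_induction_on with
  | _ i ih =>
    rw [zassenhausFiltration]
    split_ifs with hi
    · exact h1 ▸ dimSubgroup_antitone hi
    have hp0 : 0 < p := hp.out.pos
    have hceil : i ≤ p * (i ⌈/⌉ p) := le_smul_ceilDiv hp0
    have hlt : i ⌈/⌉ p < i := by
      have h2 := hp.out.two_le
      have : i ⌈/⌉ p ≤ i - 1 := by
        rw [ceilDiv_le_iff_le_smul hp0, smul_eq_mul]
        have := Nat.mul_le_mul_right (i - 1) h2
        omega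
      omega
    refine sup_le ?_ (iSup₂_le fun j hj => ?_)
    · refine le_trans (Subgroup.closure_mono ?_)
        ((powSubgroup_dimSubgroup_le_of_charP p _).trans (dimSubgroup_antitone hceil))
      rintro _ ⟨g, hg, rfl⟩
      exact ⟨g, ih _ hlt hg, rfl⟩
    · have h := commutator_dimSubgroup_le (F := F) (φ := φ) (hφ := hφ) j (i - j)
      rw [Nat.add_sub_cancel' hj.2.le] at h
      exact (Subgroup.commutator_mono (ih j hj.2) (ih (i - j) (by omega))).trans h

theorem dimSubgroup_eq_bot {k : ℕ} (hinj : Function.Injective φ)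
    (hk : ∀ x ∈ F.toFun k, x = 0) : F.dimSubgroup φ hφ k = ⊥ := by
  rw [eq_bot_iff]
  intro g hg
  rw [Subgroup.mem_bot]
  apply hinj
  rw [map_one]
  exact sub_eq_zero.1 (hk _ hg)

end RingFiltration

/-- The filtration of the upper-triangular matrices by the matrices all of whose nonzero entries
lie on or above the `k`-th superdiagonal. -/
def superdiagonalFiltration (n : ℕ) (R : Type*) [CommRing R] :
    RingFiltration (Matrix (Fin n) (Fin n) R) where
  toFun k :=
    { carrier := {M | ∀ i j : Fin n, (j : ℕ) < i + k → M i j = 0}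
      zero_mem' := fun _ _ _ => rfl
      add_mem' := fun {a b} ha hb i j h => by rw [Matrix.add_apply, ha i j h, hb i j h, add_zero]
      neg_mem' := fun {a} ha i j h => by rw [Matrix.neg_apply, ha i j h, neg_zero] }
  antitone := fun a b hab M hM i j h => hM i j (by omega)
  one_mem := fun i j h => Matrix.one_apply_ne (by rintro rfl; omega)
  mul_mem := by
    intro a b x y hx hy i j h
    rw [Matrix.mul_apply]
    refine Finset.sum_eq_zero fun k _ => ?_
    by_cases hk : (k : ℕ) < i + a
    · rw [hx i k hk, zero_mul]
    · rw [hy k j (by omega), mul_zero]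

/-- The filtration of the matrix ring by the matrices with all entries divisible by `r ^ k`. -/
def adicMatrixFiltration (n : ℕ) {R : Type*} [CommRing R] (r : R) :
    RingFiltration (Matrix (Fin n) (Fin n) R) where
  toFun k :=
    { carrier := {M | ∀ i j : Fin n, r ^ k ∣ M i j}
      zero_mem' := fun _ _ => dvd_zero _
      add_mem' := fun ha hb i j => dvd_add (ha i j) (hb i j)
      neg_mem' := fun ha i j => (dvd_neg).2 (ha i j) }
  antitone := fun a b hab M hM i j => (pow_dvd_pow r hab).trans (hM i j)
  one_mem := fun i j => by simp
  mul_mem := by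
    intro a b x y hx hy i j
    rw [Matrix.mul_apply, pow_add]
    exact Finset.dvd_sum fun k _ => mul_dvd_mul (hx i k) (hy k j)

/-- The inclusion of a subgroup of the special linear group into the matrix ring. -/
def Subgroup.toMatrixHom {n : ℕ} {R : Type*} [CommRing R]
    (H : Subgroup (Matrix.SpecialLinearGroup (Fin n) R)) : H →* Matrix (Fin n) (Fin n) R where
  toFun g := g.1.1
  map_one' := rfl
  map_mul' _ _ := rfl

theorem Subgroup.toMatrixHom_injective {n : ℕ} {R : Type*} [CommRing R]
    (H : Subgroup (Matrix.SpecialLinearGroup (Fin n) R)) : Function.Injective H.toMatrixHom :=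
  fun _ _ h => Subtype.ext (Subtype.ext h)

section Unipotent

variable (n : ℕ) (R : Type*) [CommRing R]

theorem unipotentGroup_mem_superdiagonalFiltration_zero (g : unipotentGroup n R) :
    (unipotentGroup n R).toMatrixHom g ∈ (superdiagonalFiltration n R).toFun 0 :=
  fun i j h => g.2.1 i j h

theorem unipotentGroup_dimSubgroup_one :
    (superdiagonalFiltration n R).dimSubgroup (unipotentGroup n R).toMatrixHom
      (unipotentGroup_mem_superdiagonalFiltration_zero n R) 1 = ⊤ := by
  rw [eq_top_iff]
  intro g _ i j h
  show g.1.1 i j - (1 : Matrix (Fin n) (Fin n) R) i j = 0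
  rcases (show j ≤ i from Nat.lt_succ_iff.1 h).eq_or_lt with rfl | h
  · rw [g.2.2, Matrix.one_apply_eq, sub_self]
  · rw [g.2.1 i j h, Matrix.one_apply_ne h.ne', sub_self]

theorem unipotentGroup_dimSubgroup_eq_bot :
    (superdiagonalFiltration n R).dimSubgroup (unipotentGroup n R).toMatrixHom
      (unipotentGroup_mem_superdiagonalFiltration_zero n R) n = ⊥ :=
  RingFiltration.dimSubgroup_eq_bot (Subgroup.toMatrixHom_injective _) fun x hx => by
    ext i j
    exact hx i j (by omega)

theorem isClosed_unipotentGroup_dimSubgroup [TopologicalSpace R] [T1Space R]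
    [IsTopologicalRing R] (k : ℕ) :
    IsClosed ((superdiagonalFiltration n R).dimSubgroup (unipotentGroup n R).toMatrixHom
      (unipotentGroup_mem_superdiagonalFiltration_zero n R) k : Set (unipotentGroup n R)) := by
  have e : ((superdiagonalFiltration n R).dimSubgroup (unipotentGroup n R).toMatrixHom
      (unipotentGroup_mem_superdiagonalFiltration_zero n R) k : Set (unipotentGroup n R)) =
      ⋂ (i : Fin n) (j : Fin n) (_ : (j : ℕ) < i + k),
        (fun g : unipotentGroup n R => g.1.1 i j - (1 : Matrix (Fin n) (Fin n) R) i j) ⁻¹' {0} := by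
    ext g
    simp only [Set.mem_iInter]
    rfl
  rw [e]
  refine isClosed_iInter fun i => isClosed_iInter fun j => isClosed_iInter fun _ =>
    isClosed_singleton.preimage (Continuous.sub ?_ continuous_const)
  have hv : Continuous fun g : unipotentGroup n R => g.1 := continuous_subtype_val
  exact (continuous_apply j).comp (Matrix.SpecialLinearGroup.continuous_apply _ hv i)

end Unipotent

theorem groupG_mem_adicMatrixFiltration_zero (n p : ℕ) [Fact p.Prime] (g : groupG n p) :
    (groupG n p).toMatrixHom g ∈ (adicMatrixFiltration n (p : ZMod (p ^ n))).toFun 0 :=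
  fun i j => by simp

theorem groupG_dimSubgroup_one (n p : ℕ) [Fact p.Prime] :
    (adicMatrixFiltration n (p : ZMod (p ^ n))).dimSubgroup (groupG n p).toMatrixHom
      (groupG_mem_adicMatrixFiltration_zero n p) 1 = ⊤ := by
  rw [eq_top_iff]
  intro g _ i j
  obtain ⟨hu, hd⟩ := mem_groupG.1 g.2
  show _ ∣ g.1.1 i j - (1 : Matrix (Fin n) (Fin n) (ZMod (p ^ n))) i j
  rcases lt_trichotomy i j with h | rfl | h
  · rw [Matrix.one_apply_ne h.ne, sub_zero]
    exact (pow_dvd_pow _ (Nat.sub_pos_of_lt h)).trans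
      (Ideal.mem_span_singleton.1 (hd i j h.le))
  · rw [hu.2, Matrix.one_apply_eq, sub_self]
    exact dvd_zero _
  · rw [hu.1 i j h, Matrix.one_apply_ne h.ne', sub_self]
    exact dvd_zero _

theorem natCast_mem_adicMatrixFiltration_one (n p : ℕ) (R : Type*) [CommRing R] :
    (p : Matrix (Fin n) (Fin n) R) ∈ (adicMatrixFiltration n (p : R)).toFun 1 := by
  intro i j
  rw [pow_one, ← Matrix.diagonal_natCast, Matrix.diagonal_apply]
  split_ifs
  · exact dvd_rfl
  · exact dvd_zero _

theorem groupG_dimSubgroup_eq_bot (n p : ℕ) [Fact p.Prime] :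
    (adicMatrixFiltration n (p : ZMod (p ^ n))).dimSubgroup (groupG n p).toMatrixHom
      (groupG_mem_adicMatrixFiltration_zero n p) n = ⊥ :=
  RingFiltration.dimSubgroup_eq_bot (Subgroup.toMatrixHom_injective _) fun x hx => by
    ext i j
    have h := hx i j
    rw [← Nat.cast_pow, ZMod.natCast_self] at h
    exact zero_dvd_iff.1 h

theorem corollary6p7 (n : ℕ) (hn : 1 ≤ n) :
    lowerCentralFiltration (unipotentGroup n ℤ) n = ⊥ ∧
    (∀ P : Set Nat.Primes,
      closedLowerCentralFiltration (unipotentGroup n (ZHat P)) n = ⊥) ∧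
    (∀ (p : ℕ) [Fact p.Prime],
      zassenhausFiltration (unipotentGroup n (ZMod p)) p n = ⊥) ∧
    (∀ (p : ℕ) [Fact p.Prime],
      lowerPCentralFiltration (groupG n p) p n = ⊥) := by
  obtain ⟨m, rfl⟩ := Nat.exists_eq_add_of_le' hn
  refine ⟨?_, fun P => ?_, fun p _ => ?_, fun p _ => ?_⟩
  · rw [eq_bot_iff, ← unipotentGroup_dimSubgroup_eq_bot]
    exact RingFiltration.lowerCentralFiltration_le (unipotentGroup_dimSubgroup_one _ _) m
  · rw [eq_bot_iff, ← unipotentGroup_dimSubgroup_eq_bot]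
    exact RingFiltration.closedLowerCentralFiltration_le (unipotentGroup_dimSubgroup_one _ _)
      (isClosed_unipotentGroup_dimSubgroup _ _) m
  · rw [eq_bot_iff, ← unipotentGroup_dimSubgroup_eq_bot]
    exact RingFiltration.zassenhausFiltration_le p (unipotentGroup_dimSubgroup_one _ _) (m + 1)
  · rw [eq_bot_iff, ← groupG_dimSubgroup_eq_bot]
    exact RingFiltration.lowerPCentralFiltration_le
      (natCast_mem_adicMatrixFiltration_one _ p _) (groupG_dimSubgroup_one _ p) m
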